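/- Cliques are sets of pairwise adjacent vertices, and $c_i(G)$ is the number of cliques with exactly $i$ vertices in a finite simple graph $G$. Write $$r_k(x_k,x_{k-1},\dots,x_{k-t})=\binom{x_k}{k}+\binom{x_{k-1}}{k-1}+\dots+\binom{x_{k-t}}{k-t}$$ (the empty sum is $0$). Every integer $m\ge 0$ has, for each integer $k\ge 1$, a unique representation $$m=r_k(n_k,n_{k-1})+r_{k-1}(a_{k-1},\dots,a_{k-s})$$ with integers $s\ge 0$, $n_k>n_{k-1}\ge k-2$, $a_{k-1}>a_{k-2}>\dots>a_{k-s}\ge k-s>0$ and $r_{k-2}(n_{k-1})>r_{k-1}(a_{k-1},\dots,a_{k-s})$; if $s=0$ there are no $a_i$, no condition on them, and $r_{k-1}$ and $r_k$ of the empty list are $0$. (For $k=1$ we use $\binom{-1}{-1}=1$, $\binom{-1}{0}=\binom{-1}{1}=0$, and $\binom{x}{-1}=0$ for $x\ge 0$, so that the case $n_{k-1}=k-2$ always means $m=r_k(n_k)$.) Define $$\mathrm{lgbd}_k(m):=r_{k+1}(n_k,n_{k-1})+r_k(a_{k-1},\dots,a_{k-s}).$$ **Lemma.** Let $k\ge 1$,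 let $G$ be a finite simple graph with $c_k(G)=m$, and let $m=r_k(n_k,n_{k-1})+r_{k-1}(a_{k-1},\dots,a_{k-s})$ be the representation above. If $G$ contains a clique on $n_k$ vertices, then $$c_{k+1}(G)\le \mathrm{lgbd}_k(m)=r_{k+1}(n_k,n_{k-1})+r_k(a_{k-1},\dots,a_{k-s}).$$ -/

import Mathlib

namespace CliqueBound

/-- The `i`-th clique number `c_i(G)`: the number of cliques on exactly `i` vertices. -/
noncomputable def cliqueCount {V : Type*} (G : SimpleGraph V) (i : ℕ) : ℕ :=
  (G.cliqueSet i).ncard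

/-- Binomial coefficients `C(x, y)` with integer entries. For `x, y ≥ 0` this is the usual one;
otherwise it is `0`, except that `C(x, x) = 1` for every `x`. Negative entries only occur below as
`C(-1, -1) = 1`, `C(-1, 0) = C(-1, 1) = 0` and `C(x, -1) = 0` for `x ≥ 0`, so that Pascal's rule
and `C(j - 1, j) = 0` still hold there. -/
def binom (x y : ℤ) : ℕ :=
  if x = y then 1 else if 0 ≤ x ∧ 0 ≤ y then x.toNat.choose y.toNat else 0

/-- `r_k(x_k, x_{k-1}, …, x_{k-t}) = C(x_k, k) + C(x_{k-1}, k-1) + ⋯ + C(x_{k-t}, k-t)`;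
the empty sum is `0`. -/
def r : ℤ → List ℤ → ℕ
  | _, [] => 0
  | k, x :: xs => binom x k + r (k - 1) xs

/-- With `s = a.length` and `a = [a_j, a_{j-1}, …, a_{j-s+1}]`, this says
`a_j > a_{j-1} > ⋯ > a_{j-s+1} ≥ j - s + 1 > 0`. The empty list is allowed. -/
def IsCascade (j : ℤ) (a : List ℤ) : Prop :=
  a.Pairwise (· > ·) ∧
    ∀ h : a ≠ [], j - a.length + 1 ≤ a.getLast h ∧ 0 < j - a.length + 1

/-- `m = r_k(n, n') + r_{k-1}(a_{k-1}, …, a_{k-s})`, where `n = n_k > n' = n_{k-1} ≥ k - 2`,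
`a_{k-1} > ⋯ > a_{k-s} ≥ k - s > 0` (no condition on the `a_i` if `s = 0`), and
`r_{k-2}(n_{k-1}) > r_{k-1}(a_{k-1}, …, a_{k-s})`. -/
structure IsLgbdRep (k m : ℕ) (n n' : ℤ) (a : List ℤ) : Prop where
  lt : n' < n
  le : (k : ℤ) - 2 ≤ n'
  cascade : IsCascade ((k : ℤ) - 1) a
  small : r ((k : ℤ) - 1) a < r ((k : ℤ) - 2) [n']
  eq : m = r k [n, n'] + r ((k : ℤ) - 1) a

theorem binom_self (x : ℤ) : binom x x = 1 := by simp [binom]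

theorem binom_nat (x y : ℕ) : binom x y = x.choose y := by
  unfold binom
  split_ifs with h h2
  · have : x = y := by exact_mod_cast h
    simp [this]
  · simp
  · omega

theorem binom_sub_one_self {j : ℤ} (_hj : 0 ≤ j) : binom (j - 1) j = 0 := by
  unfold binom
  split_ifs with h h2
  · omega
  · exact Nat.choose_eq_zero_of_lt (by omega)
  · rfl

theorem binom_succ {x j : ℤ} (hx : -1 ≤ x) (hj : 0 ≤ j) :
    binom (x + 1) j = binom x j + binom x (j - 1) := by
  obtain ⟨j, rfl⟩ := Int.eq_ofNat_of_zero_le hj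
  rcases eq_or_lt_of_le hx with rfl | hx
  · rcases j with _ | _ | j
    · simp [binom]
    · simp [binom]
    · have h1 : binom (-1 + 1) ((j + 1 + 1 : ℕ) : ℤ) = 0 :=
        (binom_nat 0 (j + 1 + 1)).trans (by simp)
      have h2 : ∀ y : ℤ, 0 ≤ y → binom (-1) y = 0 := fun y hy => by
        unfold binom
        split_ifs <;> omega
      have e1 := h2 ((j + 1 + 1 : ℕ) : ℤ) (by omega)
      have e2 := h2 (((j + 1 + 1 : ℕ) : ℤ) - 1) (by omega)
      exact h1.trans (by rw [e1]; exact e2.symm.trans (zero_add _).symm)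
  · obtain ⟨x, rfl⟩ := Int.eq_ofNat_of_zero_le (show 0 ≤ x by omega)
    rcases j with _ | j
    · have h1 := binom_nat (x + 1) 0
      have h2 := binom_nat x 0
      have h3 : binom (x : ℤ) (-1) = 0 := by
        unfold binom
        split_ifs <;> omega
      push_cast at h1 h2 ⊢
      simp [h1, h2, h3]
    · have h1 := binom_nat (x + 1) (j + 1)
      have h2 := binom_nat x (j + 1)
      have h3 := binom_nat x j
      push_cast at h1 h2 ⊢
      simp [h1, h2, h3, Nat.choose_succ_succ, add_comm]

theorem binom_mono {x y j : ℤ} (hx : -1 ≤ x) (hj : 0 ≤ j) (h : x ≤ y) :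
    binom x j ≤ binom y j := by
  induction y, h using Int.leInduction with
  | base => exact le_rfl
  | succ y hy ih => rw [binom_succ (by omega) hj]; omega

theorem binom_pos {x j : ℤ} (hj : 0 ≤ j) (h : j ≤ x) : 0 < binom x j := by
  have := binom_mono (x := j) (y := x) (by omega) hj h
  rw [binom_self] at this
  omega

theorem exists_lt_binom {j : ℤ} (hj : 1 ≤ j) (q : ℕ) : q < binom (j + q) j := by
  induction q with
  | zero => simp [binom_self]
  | succ q ih =>
    have := binom_succ (x := j + q) (j := j) (by omega) (by omega)
    have := binom_pos (x := j + q) (j := j - 1) (by omega) (by omega)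
    push_cast
    rw [← add_assoc]
    omega

theorem exists_binom_le {j N : ℤ} {q : ℕ} (hj : 0 ≤ j) (hN : j - 1 ≤ N) (h : q < binom N j) :
    ∃ x, j - 1 ≤ x ∧ x < N ∧ binom x j ≤ q ∧ q - binom x j < binom x (j - 1) := by
  induction N, hN using Int.leInduction with
  | base => rw [binom_sub_one_self hj] at h; omega
  | succ y hy ih =>
    by_cases hq : q < binom y j
    · obtain ⟨x, h1, h2, h3⟩ := ih hq
      exact ⟨x, h1, by omega, h3⟩
    · refine ⟨y, hy, by omega, by omega, ?_⟩
      rw [binom_succ (by omega) hj] at h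
      omega

theorem isCascade_nil (j : ℤ) : IsCascade j [] := by simp [IsCascade]

theorem isCascade_cons {j x : ℤ} {xs : List ℤ} :
    IsCascade j (x :: xs) ↔ 0 < j ∧ j ≤ x ∧ (∀ y ∈ xs, y < x) ∧ IsCascade (j - 1) xs := by
  constructor
  · rintro ⟨h1, h2⟩
    rw [List.pairwise_cons] at h1
    obtain ⟨h3, h4⟩ := h2 (by simp)
    have hc : IsCascade (j - 1) xs := by
      refine ⟨h1.2, fun h => ?_⟩
      rw [List.getLast_cons h] at h3
      push_cast [List.length_cons] at h3 h4
      constructor <;> omega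
    refine ⟨by push_cast [List.length_cons] at h4; omega, ?_, fun y hy => h1.1 y hy, hc⟩
    clear h2
    induction xs generalizing j x with
    | nil => simp at h3; exact h3
    | cons z zs ih =>
      have h5 := h1.1 z (by simp)
      rw [List.getLast_cons (by simp)] at h3
      have := ih (j := j - 1) (x := z) (List.pairwise_cons.1 h1.2)
        (by push_cast [List.length_cons] at h3 ⊢; omega)
        (by push_cast [List.length_cons] at h4 ⊢; omega) ?_
      · omega
      · refine ⟨(List.pairwise_cons.1 h1.2).2, fun h => ?_⟩
        rw [List.getLast_cons h] at h3
        push_cast [List.length_cons] at h3 h4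
        constructor <;> omega
  · rintro ⟨hj, hx, h1, h2, h3⟩
    refine ⟨List.pairwise_cons.2 ⟨fun y hy => h1 y hy, h2⟩, fun h => ?_⟩
    rcases xs with _ | ⟨z, zs⟩
    · simpa using ⟨hx, hj⟩
    · have := h3 (by simp)
      rw [List.getLast_cons (by simp)]
      push_cast [List.length_cons] at this ⊢
      constructor <;> omega

theorem r_lt_binom {j N : ℤ} {a : List ℤ} (ha : IsCascade j a) (hj : 0 ≤ j) (hN : j ≤ N)
    (h : ∀ x ∈ a, x < N) : r j a < binom N j := by
  induction a generalizing j N with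
  | nil => exact binom_pos hj hN
  | cons x xs ih =>
    obtain ⟨h0, h1, h2, h3⟩ := isCascade_cons.1 ha
    have h4 := ih h3 (by omega) (show j - 1 ≤ x by omega) h2
    have h5 := binom_succ (x := x) (j := j) (by omega) hj
    have h6 := h x (by simp)
    have h7 := binom_mono (x := x + 1) (y := N) (j := j) (by omega) hj (by omega)
    simp only [r]
    omega

theorem cascade_unique {j : ℤ} {a b : List ℤ} (ha : IsCascade j a) (hb : IsCascade j b)
    (h : r j a = r j b) : a = b := by
  induction a generalizing j b with
  | nil =>
    rcases b with _ | ⟨y, ys⟩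
    · rfl
    · obtain ⟨h0, h1, -⟩ := isCascade_cons.1 hb
      have := binom_pos h0.le h1
      simp only [r] at h
      omega
  | cons x xs ih =>
    obtain ⟨h0, h1, h2, h3⟩ := isCascade_cons.1 ha
    rcases b with _ | ⟨y, ys⟩
    · have := binom_pos h0.le h1
      simp only [r] at h
      omega
    · obtain ⟨-, k1, k2, k3⟩ := isCascade_cons.1 hb
      have e1 := r_lt_binom h3 (by omega) (show j - 1 ≤ x by omega) h2
      have e2 := r_lt_binom k3 (by omega) (show j - 1 ≤ y by omega) k2
      have e3 := binom_succ (x := x) (j := j) (by omega) h0.le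
      have e4 := binom_succ (x := y) (j := j) (by omega) h0.le
      simp only [r] at h
      have hxy : x = y := by
        rcases lt_trichotomy x y with hl | hl | hl
        · have := binom_mono (x := x + 1) (y := y) (j := j) (by omega) h0.le (by omega)
          omega
        · exact hl
        · have := binom_mono (x := y + 1) (y := x) (j := j) (by omega) h0.le (by omega)
          omega
      subst hxy
      rw [ih h3 k3 (by omega)]

theorem exists_cascade (j : ℕ) (q : ℕ) (h : j = 0 → q = 0) :
    ∃ a, IsCascade j a ∧ r j a = q := by
  induction j generalizing q with
  | zero => exact ⟨[], isCascade_nil _, by simp [r, h rfl]⟩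
  | succ j ih =>
    rcases Nat.eq_zero_or_pos q with rfl | hq
    · exact ⟨[], isCascade_nil _, by simp [r]⟩
    · obtain ⟨x, h1, -, h3, h4⟩ := exists_binom_le (j := ((j + 1 : ℕ) : ℤ)) (by omega)
        (by omega) (exists_lt_binom (by omega) q)
      have hx : ((j + 1 : ℕ) : ℤ) ≤ x := by
        rcases eq_or_lt_of_le h1 with e | e
        · exfalso
          rw [← e, binom_sub_one_self (by omega), binom_self] at h4
          omega
        · omega
      have hj : ((j + 1 : ℕ) : ℤ) - 1 = j := by push_cast; ring
      rw [hj] at h4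
      obtain ⟨a, ha, hr⟩ := ih (q - binom x ((j + 1 : ℕ) : ℤ)) (by
        rintro rfl
        have : binom x ((0 : ℕ) : ℤ) = 1 := by
          obtain ⟨x, rfl⟩ := Int.eq_ofNat_of_zero_le (show 0 ≤ x by omega)
          exact (binom_nat x 0).trans (by simp)
        omega)
      refine ⟨x :: a, isCascade_cons.2 ⟨by omega, hx, ?_, by rwa [hj]⟩, ?_⟩
      · have hd : ∀ y ∈ a.head?, y < x := by
          rcases a with _ | ⟨y, ys⟩
          · simp
          · obtain ⟨k0, k1, -⟩ := isCascade_cons.1 ha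
            simp only [List.head?_cons, Option.mem_some_iff, forall_eq']
            by_contra! hc
            have := binom_mono (x := x) (y := y) (j := j) (by omega) (by omega) hc
            simp only [r] at hr
            omega
        rcases a with _ | ⟨y, ys⟩
        · simp
        · have hy := hd y (by simp)
          obtain ⟨-, -, k2, -⟩ := isCascade_cons.1 ha
          intro z hz
          rcases List.mem_cons.1 hz with rfl | hz
          · exact hy
          · exact (k2 z hz).trans hy
      · simp only [r, hj, hr]
        omega

/-- The representation exists. -/
theorem exists_isLgbdRep {k : ℕ} (hk : 0 < k) (m : ℕ) : ∃ n n' a, IsLgbdRep k m n n' a := by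
  obtain ⟨n, h1, -, h3, h4⟩ := exists_binom_le (j := (k : ℤ)) (by omega)
    (by omega) (exists_lt_binom (by omega) m)
  obtain ⟨n', g1, g2, g3, g4⟩ := exists_binom_le (j := (k : ℤ) - 1) (by omega)
    (by omega) h4
  have hk2 : (k : ℤ) - 1 - 1 = k - 2 := by ring
  rw [hk2] at g4
  have hk1 : (((k - 1 : ℕ) : ℕ) : ℤ) = (k : ℤ) - 1 := by omega
  obtain ⟨a, ha, hr⟩ := exists_cascade (k - 1) (m - binom n k - binom n' (k - 1)) (by
    intro h
    obtain rfl : k = 1 := by omega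
    have hle : binom n' (((1 : ℕ) : ℤ) - 2) ≤ 1 := by
      unfold binom
      split_ifs <;> omega
    omega)
  rw [hk1] at ha hr
  refine ⟨n, n', a, g2, by omega, ha, ?_, ?_⟩
  · simp only [r]; omega
  · simp only [r]; omega

/-- The representation is unique. -/
theorem isLgbdRep_unique {k m : ℕ} (hk : 0 < k) {n n' p p' : ℤ} {a b : List ℤ}
    (h : IsLgbdRep k m n n' a) (h' : IsLgbdRep k m p p' b) : n = p ∧ n' = p' ∧ a = b := by
  obtain ⟨h1, h2, h3, h4, h5⟩ := h
  obtain ⟨g1, g2, g3, g4, g5⟩ := h'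
  have hk2 : (k : ℤ) - 1 - 1 = k - 2 := by ring
  simp only [r] at h4 h5 g4 g5
  have key : ∀ x : ℤ, (k : ℤ) - 2 ≤ x →
      binom (x + 1) (k - 1) = binom x (k - 1) + binom x (k - 2) := fun x hx => by
    rw [binom_succ (by omega) (by omega), hk2]
  have a1 := key n' h2
  have a2 := key p' g2
  have a3 := binom_mono (x := n' + 1) (y := n) (j := (k : ℤ) - 1) (by omega) (by omega) (by omega)
  have a4 := binom_mono (x := p' + 1) (y := p) (j := (k : ℤ) - 1) (by omega) (by omega) (by omega)
  have a5 := binom_succ (x := n) (j := (k : ℤ)) (by omega) (by omega)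
  have a6 := binom_succ (x := p) (j := (k : ℤ)) (by omega) (by omega)
  have hn : n = p := by
    rcases lt_trichotomy n p with hl | hl | hl
    · have := binom_mono (x := n + 1) (y := p) (j := (k : ℤ)) (by omega) (by omega) (by omega)
      omega
    · exact hl
    · have := binom_mono (x := p + 1) (y := n) (j := (k : ℤ)) (by omega) (by omega) (by omega)
      omega
  subst hn
  have hn' : n' = p' := by
    rcases lt_trichotomy n' p' with hl | hl | hl
    · have := binom_mono (x := n' + 1) (y := p') (j := (k : ℤ) - 1) (by omega) (by omega) (by omega)
      omega
    · exact hl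
    · have := binom_mono (x := p' + 1) (y := n') (j := (k : ℤ) - 1) (by omega) (by omega) (by omega)
      omega
  subst hn'
  exact ⟨rfl, rfl, cascade_unique h3 g3 (by omega)⟩

open Classical in
/-- `lgbd_k(m) = r_{k+1}(n_k, n_{k-1}) + r_k(a_{k-1}, …, a_{k-s})`, computed from the unique
representation of `m` above, which exists for every `k ≥ 1`. -/
noncomputable def lgbd (k m : ℕ) : ℕ :=
  if h : ∃ p : ℤ × ℤ × List ℤ, IsLgbdRep k m p.1 p.2.1 p.2.2 then
    r (k + 1) [h.choose.1, h.choose.2.1] + r k h.choose.2.2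
  else 0

/-- The value of `lgbd` can be read off any representation. -/
theorem lgbd_eq {k m : ℕ} (hk : 0 < k) {n n' : ℤ} {a : List ℤ} (h : IsLgbdRep k m n n' a) :
    lgbd k m = r (k + 1) [n, n'] + r k a := by
  have hex : ∃ p : ℤ × ℤ × List ℤ, IsLgbdRep k m p.1 p.2.1 p.2.2 := ⟨(n, n', a), h⟩
  obtain ⟨e1, e2, e3⟩ := isLgbdRep_unique hk hex.choose_spec h
  rw [lgbd, dif_pos hex, e1, e2, e3]

end CliqueBound

/-!
Fix the clique `U` on `n` vertices and call a clique outer if it is not contained in `U`. Let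
`K_j(x)` be the Kruskal–Katona function: if `x` has the cascade representation `r_j(a)`, then
`K_j(x) = r_{j+1}(a)`; in the code `K_j` is `kk (j - 1)`. Since `U` contributes `C(n, k)` and
`C(n, k + 1)` cliques, it has to be shown that `q = C(n', k - 1) + x` outer `k`-cliques, where
`x < C(n', k - 2)`, allow at most `C(n', k) + K_{k-1}(x)` outer `(k + 1)`-cliques. For an induction
this is complemented by the bound `K_{k-1}(q)` in case `q ≤ C(n', k - 1)`. The case `k = 1`, in which
`U` is the whole vertex set, is separate.

Add the vertices outside `U` one at a time. A new vertex `v` with `b` cliques on `k - 1` vertices in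
its neighbourhood creates `b` outer `k`-cliques, and at most `K_{k-1}(b)` outer `(k + 1)`-cliques.
If `b ≤ C(n', k - 1)`, the bound survives by the exchange inequality `kk_add_le`: values of `K_j` at
two numbers up to `C(N, j)` have the largest sum, for fixed sum of arguments, when one of them is
`0` or `C(N, j)`. If `b = C(n', k - 1) + z` with `z > 0`, let `w` be the number of outer `k`-cliques
before `v` is added. The `k`-cliques in the neighbourhood of `v` number at most
`C(n', k) + K_{k-2}(z)` by Kruskal–Katona. They also number at most `C(n', k) + w`, because `v` has
at most `n'` neighbours in `U`, and the `k`-cliques of its neighbourhood that leave `U` were outer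
already. The bound survives by the cone inequality `kk_add_min_le`, that is
`K_j(w) + min(w, K_{j-1}(z)) ≤ K_j(w + z)`.

The exchange inequality, the cone inequality and the Kruskal–Katona theorem `card_filled_le` are
proved together by induction. Kruskal–Katona for `K_j` follows from the cone inequality for `K_j` by
deleting vertices; the exchange inequality for `K_j` follows from Kruskal–Katona by uncrossing two
extremal families `A` and `σ(B)` into `A ∪ σ(B)` and `A ∩ σ(B)`, for a permutation `σ` of the ground
set; and the cone inequality for `K_{j+1}` is arithmetic from the exchange and cone inequalities for
`K_j`.
-/

namespace CliqueBound

open Finset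

/-! ### The Kruskal–Katona function -/

theorem le_add_choose_succ (a i : ℕ) : a ≤ (a + i).choose (i + 1) := by
  induction a with
  | zero => exact Nat.zero_le _
  | succ a ih =>
    have h := Nat.choose_succ_succ' (a + i) i
    have h1 : 0 < (a + i).choose i := Nat.choose_pos (by omega)
    rw [show a + 1 + i = a + i + 1 by omega, h]
    omega

theorem exists_eq_choose_add (i a : ℕ) :
    ∃ M z, i ≤ M ∧ a = M.choose (i + 1) + z ∧ z < M.choose i := by
  have hex : ∃ N : ℕ, a < N.choose (i + 1) := ⟨a + 1 + i, le_add_choose_succ (a + 1) i⟩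
  classical
  obtain ⟨N, hN, hmin⟩ : ∃ N : ℕ, a < N.choose (i + 1) ∧ ∀ M < N, M.choose (i + 1) ≤ a :=
    ⟨Nat.find hex, Nat.find_spec hex, fun M hM => not_lt.1 (Nat.find_min hex hM)⟩
  have hiN : i + 1 ≤ N := by
    by_contra! h
    rw [Nat.choose_eq_zero_of_lt h] at hN
    omega
  obtain ⟨M, rfl⟩ : ∃ M, N = M + 1 := ⟨N - 1, by omega⟩
  have h1 := hmin M (by omega)
  have h2 := Nat.choose_succ_succ' M i
  exact ⟨M, a - M.choose (i + 1), by omega, by omega, by omega⟩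

theorem choose_add_unique {i M M' z z' : ℕ} (h : M.choose (i + 1) + z = M'.choose (i + 1) + z')
    (hz : z < M.choose i) (hz' : z' < M'.choose i) : M = M' ∧ z = z' := by
  have h1 := Nat.choose_succ_succ' M i
  have h2 := Nat.choose_succ_succ' M' i
  have hM : M = M' := by
    rcases lt_trichotomy M M' with hl | hl | hl
    · have := Nat.choose_le_choose (i + 1) (show M + 1 ≤ M' by omega)
      omega
    · exact hl
    · have := Nat.choose_le_choose (i + 1) (show M' + 1 ≤ M by omega)
      omega
  subst hM
  exact ⟨rfl, by omega⟩

/-- The Kruskal–Katona function in upper form: `kk i a` is the largest number of `(i + 2)`-sets all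
of whose `(i + 1)`-subsets belong to a family of `a` sets of size `i + 1`. It is defined by the
greedy recursion along the cascade representation of `a`; indices are shifted by one because there
is no such bound for families of sets of size `0`. -/
noncomputable def kk : ℕ → ℕ → ℕ
  | 0, a => a.choose 2
  | i + 1, a => (exists_eq_choose_add (i + 1) a).choose.choose (i + 3) +
      kk i (exists_eq_choose_add (i + 1) a).choose_spec.choose

theorem kk_succ_of_lt {i M z : ℕ} (hz : z < M.choose (i + 1)) :
    kk (i + 1) (M.choose (i + 2) + z) = M.choose (i + 3) + kk i z := by
  have h := (exists_eq_choose_add (i + 1) (M.choose (i + 2) + z)).choose_spec.choose_spec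
  obtain ⟨h1, h2⟩ := choose_add_unique h.2.1 hz h.2.2
  rw [kk]
  exact congrArg₂ (fun M z => M.choose (i + 3) + kk i z) h1.symm h2.symm

@[simp]
theorem kk_zero_right (i : ℕ) : kk i 0 = 0 := by
  induction i with
  | zero => rfl
  | succ i ih =>
    have := kk_succ_of_lt (i := i) (M := i + 1) (z := 0) (by simp)
    rw [Nat.choose_eq_zero_of_lt (show i + 1 < i + 2 by omega),
      Nat.choose_eq_zero_of_lt (show i + 1 < i + 3 by omega)] at this
    simpa [ih] using this

theorem kk_choose (i N : ℕ) : kk i (N.choose (i + 1)) = N.choose (i + 2) := by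
  rcases i with _ | i
  · simp [kk]
  · by_cases h : i + 1 ≤ N
    · simpa using kk_succ_of_lt (i := i) (M := N) (z := 0) (Nat.choose_pos h)
    · rw [Nat.choose_eq_zero_of_lt (show N < i + 1 + 1 by omega),
        Nat.choose_eq_zero_of_lt (show N < i + 1 + 2 by omega), kk_zero_right]

theorem kk_succ {i M z : ℕ} (hz : z ≤ M.choose (i + 1)) :
    kk (i + 1) (M.choose (i + 2) + z) = M.choose (i + 3) + kk i z := by
  rcases hz.lt_or_eq with h | rfl
  · exact kk_succ_of_lt h
  · have h1 := kk_choose (i + 1) (M + 1)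
    rw [Nat.choose_succ_succ' M (i + 1), Nat.choose_succ_succ' M (i + 1 + 1)] at h1
    rw [kk_choose, add_comm (M.choose (i + 2)), add_comm (M.choose (i + 3))]
    exact h1

theorem kk_mono (i : ℕ) : Monotone (kk i) := by
  induction i with
  | zero => exact fun a b h => Nat.choose_le_choose 2 h
  | succ i ih =>
    refine monotone_nat_of_le_succ fun a => ?_
    obtain ⟨M, z, -, rfl, hz⟩ := exists_eq_choose_add (i + 1) a
    rw [add_assoc _ z 1, kk_succ hz.le, kk_succ (show z + 1 ≤ _ from hz)]
    have := ih (Nat.le_add_right z 1)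
    omega

/-! ### Filled sets of a family -/

section Families

variable {α : Type*} [DecidableEq α]

/-- The `(r + 1)`-subsets of `X` all of whose `r`-subsets belong to `A`. -/
def filled (X : Finset α) (r : ℕ) (A : Finset (Finset α)) : Finset (Finset α) :=
  {t ∈ X.powersetCard (r + 1) | ∀ x ∈ t, t.erase x ∈ A}

theorem mem_filled {X : Finset α} {r : ℕ} {A : Finset (Finset α)} {t : Finset α} :
    t ∈ filled X r A ↔ t ⊆ X ∧ #t = r + 1 ∧ ∀ x ∈ t, t.erase x ∈ A := by
  simp [filled, mem_powersetCard, and_assoc]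

/-- The value of `kk` is attained inside any large enough ground set. -/
theorem exists_le_card_filled (X : Finset α) (i a : ℕ) (ha : a ≤ (#X).choose (i + 1)) :
    ∃ A ⊆ X.powersetCard (i + 1), #A = a ∧ kk i a ≤ #(filled X (i + 1) A) := by
  induction X using Finset.induction_on generalizing i a with
  | empty =>
    obtain rfl : a = 0 := by simpa using ha
    exact ⟨∅, by simp, rfl, by simp⟩
  | insert v X hv ih =>
    by_cases h : a ≤ (#X).choose (i + 1)
    · obtain ⟨A, hA, hc, hk⟩ := ih i a h
      refine ⟨A, hA.trans (powersetCard_mono (subset_insert _ _)), hc, hk.trans (card_le_card ?_)⟩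
      intro t ht
      rw [mem_filled] at ht ⊢
      exact ⟨ht.1.trans (subset_insert _ _), ht.2⟩
    · push Not at h
      rw [card_insert_of_notMem hv, Nat.choose_succ_succ'] at ha
      obtain ⟨z, rfl⟩ : ∃ z, a = (#X).choose (i + 1) + z := ⟨_, (Nat.add_sub_cancel' h.le).symm⟩
      have hz : z ≤ (#X).choose i := by omega
      -- All `(i + 1)`-subsets of `X`, together with the cone with apex `v` over a family `B`.
      have hcone : ∀ (r : ℕ) (B : Finset (Finset α)), B ⊆ X.powersetCard r →
          X.powersetCard (r + 1) ∪ B.image (insert v) ⊆ (insert v X).powersetCard (r + 1) ∧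
          #(X.powersetCard (r + 1) ∪ B.image (insert v)) = (#X).choose (r + 1) + #B := by
        intro r B hB
        have hBv : ∀ b ∈ B, v ∉ b := fun b hb hvb => hv ((mem_powersetCard.1 (hB hb)).1 hvb)
        constructor
        · refine union_subset (powersetCard_mono (subset_insert _ _)) fun s hs => ?_
          obtain ⟨b, hb, rfl⟩ := mem_image.1 hs
          obtain ⟨h1, h2⟩ := mem_powersetCard.1 (hB hb)
          exact mem_powersetCard.2 ⟨insert_subset_insert _ h1,
            by rw [card_insert_of_notMem (hBv b hb), h2]⟩
        · rw [card_union_of_disjoint, card_powersetCard, card_image_of_injOn]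
          · intro b hb c hc hbc
            rw [← erase_insert (hBv b hb), ← erase_insert (hBv c hc)]
            exact congrArg (fun s => erase s v) hbc
          · rw [disjoint_left]
            intro s hs hs'
            obtain ⟨b, -, rfl⟩ := mem_image.1 hs'
            exact hv ((mem_powersetCard.1 hs).1 (mem_insert_self _ _))
      -- It suffices to fill all `(i + 2)`-subsets of `X` and the cone over a family `D`.
      suffices hs : ∃ B ⊆ X.powersetCard i, #B = z ∧ ∃ D ⊆ X.powersetCard (i + 1),
          kk i ((#X).choose (i + 1) + z) ≤ (#X).choose (i + 2) + #D ∧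
          ∀ d ∈ D, ∀ x ∈ d, d.erase x ∈ B by
        obtain ⟨B, hB, hBz, D, hD, hk, hDB⟩ := hs
        refine ⟨_, (hcone i B hB).1, by rw [(hcone i B hB).2, hBz], ?_⟩
        rw [← (hcone (i + 1) D hD).2] at hk
        refine hk.trans (card_le_card fun t ht => ?_)
        have htc := mem_powersetCard.1 ((hcone (i + 1) D hD).1 ht)
        refine mem_filled.2 ⟨htc.1, htc.2, fun x hx => mem_union.2 ?_⟩
        rcases mem_union.1 ht with ht | ht
        · obtain ⟨h1, h2⟩ := mem_powersetCard.1 ht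
          exact .inl (mem_powersetCard.2 ⟨(erase_subset _ _).trans h1,
            by rw [card_erase_of_mem hx, h2]; rfl⟩)
        · obtain ⟨d, hd, rfl⟩ := mem_image.1 ht
          have hdX := mem_powersetCard.1 (hD hd)
          have hvd : v ∉ d := fun h => hv (hdX.1 h)
          rcases mem_insert.1 hx with rfl | hxd
          · rw [erase_insert hvd]
            exact .inl (hD hd)
          · refine .inr (mem_image.2 ⟨d.erase x, hDB d hd x hxd, ?_⟩)
            rw [erase_insert_of_ne]
            rintro rfl
            exact hvd hxd
      rcases i with _ | i
      · -- On level `0` the base of the cone is `{∅}`, and all points of `X` may be joined to `v`.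
        obtain rfl : z = 1 := by simp at h hz; omega
        refine ⟨{∅}, by simp, rfl, X.powersetCard 1, subset_rfl, ?_, fun d hd x hx => ?_⟩
        · simp [kk, Nat.choose_succ_succ', add_comm]
        · have h1 := (mem_powersetCard.1 hd).2
          rw [mem_singleton, ← card_eq_zero, card_erase_of_mem hx, h1]
      · obtain ⟨B, hB, hBz, hk⟩ := ih i z hz
        refine ⟨B, hB, hBz, filled X (i + 1) B, filter_subset _ _, ?_,
          fun d hd => (mem_filled.1 hd).2.2⟩
        rw [kk_succ hz]
        exact Nat.add_le_add_left hk _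

theorem filled_union_inter (X : Finset α) (r : ℕ) (A B : Finset (Finset α)) :
    #(filled X r A) + #(filled X r B) ≤ #(filled X r (A ∪ B)) + #(filled X r (A ∩ B)) := by
  rw [← card_union_add_card_inter]
  refine add_le_add (card_le_card fun t ht => ?_) (card_le_card fun t ht => ?_)
  · simp only [mem_union, mem_filled] at ht ⊢
    rcases ht with h | h
    · exact ⟨h.1, h.2.1, fun x hx => .inl (h.2.2 x hx)⟩
    · exact ⟨h.1, h.2.1, fun x hx => .inr (h.2.2 x hx)⟩
  · simp only [mem_inter, mem_filled] at ht ⊢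
    exact ⟨ht.1.1, ht.1.2.1, fun x hx => ⟨ht.1.2.2 x hx, ht.2.2.2 x hx⟩⟩

theorem card_filled_le_map [Fintype α] (σ : Equiv.Perm α) (r : ℕ) (B : Finset (Finset α)) :
    #(filled univ r B) ≤ #(filled univ r (B.map (mapEmbedding σ.toEmbedding).toEmbedding)) := by
  rw [← card_map (mapEmbedding σ.toEmbedding).toEmbedding]
  refine card_le_card fun t ht => ?_
  obtain ⟨s, hs, rfl⟩ := mem_map.1 ht
  rw [mem_filled] at hs ⊢
  refine ⟨subset_univ _, by simpa using hs.2.1, fun y hy => ?_⟩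
  obtain ⟨x, hx, rfl⟩ := mem_map.1 (show y ∈ s.map σ.toEmbedding from hy)
  refine mem_map.2 ⟨s.erase x, hs.2.2 x hx, ?_⟩
  exact map_erase _ _ _

theorem exists_perm_map_eq [Fintype α] {s t : Finset α} (h : #s = #t) :
    ∃ σ : Equiv.Perm α, s.map σ.toEmbedding = t := by
  let e : {x // x ∈ s} ≃ {x // x ∈ t} := Fintype.equivOfCardEq (by simpa using h)
  refine ⟨e.extendSubtype, ?_⟩
  refine eq_of_subset_of_card_le (fun y hy => ?_) (by simp [h])
  obtain ⟨x, hx, rfl⟩ := mem_map.1 hy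
  exact e.extendSubtype_mem x hx

theorem card_filled_one_le (X : Finset α) (A : Finset (Finset α)) :
    #(filled X 1 A) ≤ (#A).choose 2 := by
  have hinj : Function.Injective (fun x : α => ({x} : Finset α)) := singleton_injective
  have h1 : filled X 1 A ⊆ ({x ∈ X | {x} ∈ A}).powersetCard 2 := by
    intro t ht
    obtain ⟨h1, h2, h3⟩ := mem_filled.1 ht
    refine mem_powersetCard.2 ⟨fun x hx => mem_filter.2 ⟨h1 hx, ?_⟩, h2⟩
    obtain ⟨y, hy⟩ := card_eq_one.1 (show #(t.erase x) = 1 by rw [card_erase_of_mem hx, h2])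
    have hyt : y ∈ t.erase x := by simp [hy]
    have hxy : t.erase y = {x} := by
      refine (eq_of_subset_of_card_le ?_ ?_).symm
      · simpa using ⟨(ne_of_mem_erase hyt).symm, hx⟩
      · rw [card_erase_of_mem (mem_of_mem_erase hyt), h2]; simp
    exact hxy ▸ h3 y (mem_of_mem_erase hyt)
  refine (card_le_card h1).trans ?_
  rw [card_powersetCard]
  refine Nat.choose_le_choose 2 ?_
  rw [← card_image_of_injective _ hinj]
  refine card_le_card fun s hs => ?_
  obtain ⟨x, hx, rfl⟩ := mem_image.1 hs
  exact (mem_filter.1 hx).2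

/-- Splitting a family at a vertex `v` of the ground set: a filled set through `v` is a member of
the deletion that is filled by the link. -/
theorem card_filled_insert_le {X : Finset α} {v : α} (r : ℕ)
    {A : Finset (Finset α)} (hA : A ⊆ (insert v X).powersetCard (r + 1)) :
    ∃ A₀ ⊆ X.powersetCard (r + 1), ∃ A₁ ⊆ X.powersetCard r, #A₀ + #A₁ = #A ∧
      #(filled (insert v X) (r + 1) A) ≤
        #(filled X (r + 1) A₀) + min #A₀ #(filled X r A₁) := by
  have hsub : ∀ s : Finset α, s ⊆ insert v X → v ∉ s → s ⊆ X := fun s hs hvs =>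
    (subset_insert_iff_of_notMem hvs).1 hs
  have hinj : ∀ F : Finset (Finset α), Set.InjOn (fun s : Finset α => s.erase v)
      (F.filter (v ∈ ·) : Finset (Finset α)) :=
    fun F => (erase_injOn' v).mono fun s hs => (mem_filter.1 (mem_coe.1 hs)).2
  refine ⟨A.filter (v ∉ ·), fun s hs => ?_, (A.filter (v ∈ ·)).image (fun s => s.erase v),
    fun s hs => ?_, ?_, ?_⟩
  · obtain ⟨h1, h2⟩ := mem_filter.1 hs
    obtain ⟨h3, h4⟩ := mem_powersetCard.1 (hA h1)
    exact mem_powersetCard.2 ⟨hsub s h3 h2, h4⟩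
  · obtain ⟨t, ht, rfl⟩ := mem_image.1 hs
    obtain ⟨h1, h2⟩ := mem_filter.1 ht
    obtain ⟨h3, h4⟩ := mem_powersetCard.1 (hA h1)
    refine mem_powersetCard.2 ⟨subset_insert_iff.1 h3, by rw [card_erase_of_mem h2, h4]; rfl⟩
  · rw [card_image_of_injOn (hinj A), add_comm, card_filter_add_card_filter_not]
  · rw [← card_filter_add_card_filter_not (s := filled (insert v X) (r + 1) A) (v ∈ ·), add_comm]
    refine add_le_add (card_le_card fun t ht => ?_) ?_
    · obtain ⟨h1, h2⟩ := mem_filter.1 ht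
      obtain ⟨h3, h4, h5⟩ := mem_filled.1 h1
      exact mem_filled.2 ⟨hsub t h3 h2, h4, fun x hx => mem_filter.2
        ⟨h5 x hx, fun h => h2 (mem_of_mem_erase h)⟩⟩
    · rw [← card_image_of_injOn (hinj (filled (insert v X) (r + 1) A))]
      refine le_min (card_le_card fun s hs => ?_) (card_le_card fun s hs => ?_)
      all_goals
        obtain ⟨t, ht, rfl⟩ := mem_image.1 hs
        obtain ⟨h1, h2⟩ := mem_filter.1 ht
        obtain ⟨h3, h4, h5⟩ := mem_filled.1 h1
      · exact mem_filter.2 ⟨h5 v h2, notMem_erase _ _⟩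
      · refine mem_filled.2 ⟨subset_insert_iff.1 h3, by rw [card_erase_of_mem h2, h4]; rfl,
          fun x hx => mem_image.2 ⟨t.erase x, mem_filter.2 ⟨h5 x (mem_of_mem_erase hx), ?_⟩,
            erase_right_comm⟩⟩
        exact mem_erase.2 ⟨(ne_of_mem_erase hx).symm, h2⟩

end Families

/-! ### Exchange and cone inequalities, and the Kruskal–Katona theorem -/

/-- If `kk i` bounds filled sets, it has the following exchange property: among pairs with a fixed
sum and both entries at most `N.choose (i + 1)`, the sum of values is largest at the extreme pair. -/
theorem kk_add_le_of_bound {i : ℕ}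
    (hkk : ∀ (N : ℕ) (A : Finset (Finset (Fin N))), A ⊆ univ.powersetCard (i + 1) →
      #(filled univ (i + 1) A) ≤ kk i #A)
    {N a b : ℕ} (ha : a ≤ N.choose (i + 1)) (hb : b ≤ N.choose (i + 1)) :
    kk i a + kk i b ≤
      kk i (min (a + b) (N.choose (i + 1))) + kk i (a + b - N.choose (i + 1)) := by
  wlog hba : b ≤ a generalizing a b
  · have := this hb ha (by omega)
    rwa [add_comm (kk i b), add_comm b] at this
  induction b using Nat.strong_induction_on generalizing a with
  | _ b ih =>
  rcases Nat.eq_zero_or_pos b with rfl | hb0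
  · simp [ha]
  rcases ha.eq_or_lt with rfl | ha'
  · simp
  have hN : #(univ : Finset (Fin N)) = N := card_fin N
  obtain ⟨A, hA, rfl, hkA⟩ := exists_le_card_filled (univ : Finset (Fin N)) i a (by rwa [hN])
  obtain ⟨B, hB, rfl, hkB⟩ := exists_le_card_filled (univ : Finset (Fin N)) i b (by rwa [hN])
  -- Move `B` by a permutation so that it is no longer contained in `A`, and uncross.
  obtain ⟨s, hs⟩ := card_pos.1 hb0
  obtain ⟨t, htP, htA⟩ : ∃ t ∈ (univ : Finset (Fin N)).powersetCard (i + 1), t ∉ A := by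
    by_contra! h
    have := card_le_card (show (univ : Finset (Fin N)).powersetCard (i + 1) ⊆ A from h)
    rw [card_powersetCard, hN] at this
    omega
  obtain ⟨σ, hσ⟩ := exists_perm_map_eq
    ((mem_powersetCard.1 (hB hs)).2.trans (mem_powersetCard.1 htP).2.symm)
  set B' := B.map (mapEmbedding σ.toEmbedding).toEmbedding with hB'
  have hcB : #B' = #B := card_map _
  have hB'P : B' ⊆ univ.powersetCard (i + 1) := by
    intro x hx
    obtain ⟨y, hy, rfl⟩ := mem_map.1 hx
    refine mem_powersetCard.2 ⟨subset_univ _, ?_⟩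
    exact (card_map _).trans (mem_powersetCard.1 (hB hy)).2
  have htB' : t ∈ B' := mem_map.2 ⟨s, hs, hσ⟩
  have hlt : #A < #(A ∪ B') := card_lt_card
    ⟨subset_union_left, fun h => htA (h (mem_union_right _ htB'))⟩
  have hsum := card_union_add_card_inter A B'
  have h1 := filled_union_inter univ (i + 1) A B'
  have h2 : _ ≤ #(filled univ (i + 1) B') := card_filled_le_map σ (i + 1) B
  have h3 := hkk N _ (union_subset hA hB'P)
  have h4 := hkk N _ (inter_subset_left.trans hA : A ∩ B' ⊆ _)
  have h5 : #(A ∪ B') ≤ N.choose (i + 1) := by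
    have := card_le_card (union_subset hA hB'P)
    rwa [card_powersetCard, hN] at this
  have h6 := ih #(A ∩ B') (by omega) h5 (by omega) (by omega)
  rw [hsum, hcB] at h6
  omega

/-- Arithmetic form of adding a cone over a family of `z` sets of size `i + 1` to a family of `w`
sets of size `i + 2`. -/
theorem kk_add_min_le_of_exchange {i : ℕ}
    (hex : ∀ N a b : ℕ, a ≤ N.choose (i + 1) → b ≤ N.choose (i + 1) → kk i a + kk i b ≤
      kk i (min (a + b) (N.choose (i + 1))) + kk i (a + b - N.choose (i + 1)))
    (hpred : ∀ l, i = l + 1 → ∀ w z, kk i w + min w (kk l z) ≤ kk i (w + z)) (w z : ℕ) :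
    kk (i + 1) w + min w (kk i z) ≤ kk (i + 1) (w + z) := by
  obtain ⟨M, w', -, rfl, hw'⟩ := exists_eq_choose_add (i + 1) w
  have hp1 := Nat.choose_succ_succ' M i
  have hp2 := Nat.choose_succ_succ' M (i + 1)
  have hp3 := Nat.choose_succ_succ' M (i + 2)
  simp only [add_assoc, Nat.reduceAdd] at hp1 hp2 hp3 hw' ⊢
  rw [kk_succ hw'.le]
  rcases le_or_gt z (M.choose (i + 1)) with hz | hz
  · have h1 := hex M w' z hw'.le hz
    refine (Nat.add_le_add_left (min_le_right _ _) _).trans ?_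
    rcases le_total (w' + z) (M.choose (i + 1)) with h | h
    · rw [min_eq_left h, Nat.sub_eq_zero_of_le h, kk_zero_right] at h1
      rw [kk_succ h]
      omega
    · rw [min_eq_right h, kk_choose] at h1
      have h2 : M.choose (i + 2) + (w' + z) =
          (M + 1).choose (i + 2) + (w' + z - M.choose (i + 1)) := by omega
      rw [h2, kk_succ (by omega)]
      omega
  · -- Beyond `(M + 1).choose (i + 1)` the minimum is the first entry, so `z` may be lowered.
    wlog hz' : z ≤ (M + 1).choose (i + 1) generalizing z
    · have h1 := this ((M + 1).choose (i + 1)) (by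
        have : 0 < M.choose i := by
          by_contra! h0
          have hMi : M < i := by
            by_contra! h
            exact absurd (Nat.choose_pos h) (by omega)
          rw [Nat.choose_eq_zero_of_lt (show M < i + 1 by omega)] at hw'
          omega
        omega) le_rfl
      rw [kk_choose, min_eq_left (by omega)] at h1
      refine (Nat.add_le_add_left (min_le_left _ _) _).trans (h1.trans (kk_mono _ ?_))
      omega
    obtain ⟨z', rfl⟩ : ∃ z', z = M.choose (i + 1) + z' := ⟨_, (Nat.add_sub_cancel' hz.le).symm⟩
    have hz1 : z' ≤ M.choose i := by omega
    have h2 : M.choose (i + 2) + (w' + (M.choose (i + 1) + z')) =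
        (M + 1).choose (i + 2) + (w' + z') := by omega
    rw [h2, kk_succ (by omega)]
    rcases i with _ | l
    · obtain rfl : z' = 1 := by simp at hz1 hz; omega
      have h3 : kk 0 (w' + 1) = w' + kk 0 w' := by
        simp [kk, Nat.choose_succ_succ']
      refine (Nat.add_le_add_left (min_le_left _ _) _).trans ?_
      simp only [zero_add] at *
      omega
    · rw [kk_succ hz1]
      have h3 := hpred l rfl w' z'
      simp only [add_assoc, Nat.reduceAdd] at *
      omega

/-- Counting filled sets by removing the vertices of the ground set one at a time. -/
theorem card_filled_le_of_cone {n : ℕ}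
    (hcone : ∀ i < n, ∀ w z, kk (i + 1) w + min w (kk i z) ≤ kk (i + 1) (w + z))
    {α : Type*} [DecidableEq α] (X : Finset α) (A : Finset (Finset α)) {i : ℕ} (hi : i ≤ n)
    (hA : A ⊆ X.powersetCard (i + 1)) : #(filled X (i + 1) A) ≤ kk i #A := by
  induction i generalizing X A with
  | zero => exact card_filled_one_le X A
  | succ i ih =>
    induction X using Finset.induction_on generalizing A with
    | empty =>
      have : filled (∅ : Finset α) (i + 1 + 1) A = ∅ := by
        simp [filled]
      simp [this]
    | insert v X hv ihX =>
      obtain ⟨A₀, h0, A₁, h1, hc, hle⟩ := card_filled_insert_le (i + 1) hA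
      have h2 := ihX A₀ h0
      have h3 := ih X A₁ (by omega) h1
      have h4 := hcone i (by omega) #A₀ #A₁
      rw [hc] at h4
      have h5 := min_le_min_left #A₀ h3
      omega

theorem kk_add_min_le (i w z : ℕ) : kk (i + 1) w + min w (kk i z) ≤ kk (i + 1) (w + z) := by
  induction i using Nat.strong_induction_on generalizing w z with
  | _ i ih =>
  refine kk_add_min_le_of_exchange (fun N a b ha hb => kk_add_le_of_bound (fun N A hA => ?_) ha hb)
    (fun l hl w z => ?_) w z
  · exact card_filled_le_of_cone (n := i) (fun i hi w z => ih i hi w z) _ _ le_rfl hA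
  · subst hl
    exact ih l (by omega) w z

/-- The Kruskal–Katona theorem. -/
theorem card_filled_le {α : Type*} [DecidableEq α] {X : Finset α} {i : ℕ} {A : Finset (Finset α)}
    (hA : A ⊆ X.powersetCard (i + 1)) : #(filled X (i + 1) A) ≤ kk i #A :=
  card_filled_le_of_cone (n := i) (fun i _ w z => kk_add_min_le i w z) X A le_rfl hA

theorem kk_add_le {i N a b : ℕ} (ha : a ≤ N.choose (i + 1)) (hb : b ≤ N.choose (i + 1)) :
    kk i a + kk i b ≤
      kk i (min (a + b) (N.choose (i + 1))) + kk i (a + b - N.choose (i + 1)) :=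
  kk_add_le_of_bound (fun _ _ hA => card_filled_le hA) ha hb

theorem kk_superadditive (i a b : ℕ) : kk i a + kk i b ≤ kk i (a + b) := by
  have h := le_add_choose_succ (a + b) i
  have := kk_add_le (i := i) (N := a + b + i) (a := a) (b := b) (by omega) (by omega)
  rwa [min_eq_left h, Nat.sub_eq_zero_of_le h, kk_zero_right, add_zero] at this

/-! ### Cliques not contained in a fixed clique -/

section Graph

variable {V : Type*} (G : SimpleGraph V)

open Classical in
/-- The cliques on `r` vertices inside `X`. -/
noncomputable def cliquesIn (X : Finset V) (r : ℕ) : Finset (Finset V) :=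
  {s ∈ X.powersetCard r | G.IsClique (s : Set V)}

open Classical in
/-- The cliques on `r` vertices inside `X` that are not contained in `U`. -/
noncomputable def outerCliques (U X : Finset V) (r : ℕ) : Finset (Finset V) :=
  {s ∈ cliquesIn G X r | ¬ s ⊆ U}

open Classical in
/-- The neighbours of `v` in `X`. -/
noncomputable def nbrsIn (X : Finset V) (v : V) : Finset V := {x ∈ X | G.Adj v x}

variable {G}

theorem mem_cliquesIn {X : Finset V} {r : ℕ} {s : Finset V} :
    s ∈ cliquesIn G X r ↔ s ⊆ X ∧ #s = r ∧ G.IsClique (s : Set V) := by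
  simp [cliquesIn, mem_powersetCard, and_assoc]

theorem mem_outerCliques {U X : Finset V} {r : ℕ} {s : Finset V} :
    s ∈ outerCliques G U X r ↔ (s ⊆ X ∧ #s = r ∧ G.IsClique (s : Set V)) ∧ ¬ s ⊆ U := by
  simp only [outerCliques, mem_filter, mem_cliquesIn]

theorem nbrsIn_subset (X : Finset V) (v : V) : nbrsIn G X v ⊆ X := by
  classical exact filter_subset _ _

theorem cliqueCount_eq [Fintype V] (r : ℕ) : cliqueCount G r = #(cliquesIn G univ r) := by
  rw [cliqueCount, ← Set.ncard_coe_finset]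
  congr 1
  ext s
  rw [SimpleGraph.mem_cliqueSet_iff, SimpleGraph.isNClique_iff, mem_coe, mem_cliquesIn]
  simp [and_comm]

variable [DecidableEq V]

/-- The Kruskal–Katona bound for consecutive clique numbers. -/
theorem card_cliquesIn_succ_le (X : Finset V) (i : ℕ) :
    #(cliquesIn G X (i + 2)) ≤ kk i #(cliquesIn G X (i + 1)) := by
  refine le_trans (card_le_card fun t ht => ?_)
    (card_filled_le (X := X) (i := i) (A := cliquesIn G X (i + 1)) fun s hs => mem_powersetCard.2
      ⟨(mem_cliquesIn.1 hs).1, (mem_cliquesIn.1 hs).2.1⟩)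
  obtain ⟨h1, h2, h3⟩ := mem_cliquesIn.1 ht
  refine mem_filled.2 ⟨h1, h2, fun x hx => mem_cliquesIn.2 ⟨(erase_subset _ _).trans h1, ?_, ?_⟩⟩
  · rw [card_erase_of_mem hx, h2]; rfl
  · exact h3.subset (coe_subset.2 (erase_subset _ _))

/-- Every `r`-subset of `X ∩ U` is a clique, since `U` is one. -/
theorem card_cliquesIn_eq {U X : Finset V} (hU : G.IsClique (U : Set V)) (r : ℕ) :
    #(cliquesIn G X r) = (#(X ∩ U)).choose r + #(outerCliques G U X r) := by
  classical
  rw [← card_powersetCard, outerCliques,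
    ← card_filter_add_card_filter_not (s := cliquesIn G X r) (· ⊆ U)]
  congr 2
  · ext s
    rw [mem_filter, mem_cliquesIn, mem_powersetCard, subset_inter_iff]
    constructor
    · rintro ⟨⟨h1, h2, -⟩, h3⟩
      exact ⟨⟨h1, h3⟩, h2⟩
    · rintro ⟨⟨h1, h3⟩, h2⟩
      exact ⟨⟨h1, h2, hU.subset (coe_subset.2 h3)⟩, h3⟩
  · ext s
    simp only [mem_filter]

/-- The new outer cliques at a vertex `v` are the cliques of its neighbourhood with `v` added. -/
theorem card_outerCliques_insert {U X : Finset V} {v : V} (hU : v ∉ U) (hX : v ∉ X) (r : ℕ) :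
    #(outerCliques G U (insert v X) (r + 1)) =
      #(outerCliques G U X (r + 1)) + #(cliquesIn G (nbrsIn G X v) r) := by
  classical
  rw [← card_filter_add_card_filter_not (s := outerCliques G U (insert v X) (r + 1)) (v ∉ ·)]
  congr 1
  · congr 1
    ext s
    rw [mem_filter, mem_outerCliques, mem_outerCliques]
    constructor
    · rintro ⟨⟨⟨h1, h2⟩, h3⟩, h4⟩
      exact ⟨⟨(subset_insert_iff_of_notMem h4).1 h1, h2⟩, h3⟩
    · rintro ⟨⟨h1, h2⟩, h3⟩
      exact ⟨⟨⟨h1.trans (subset_insert _ _), h2⟩, h3⟩, fun h => hX (h1 h)⟩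
  · refine card_bij' (fun s _ => s.erase v) (fun s _ => insert v s) (fun s hs => ?_)
      (fun s hs => ?_) (fun s hs => ?_) (fun s hs => ?_)
    · rw [mem_filter, mem_outerCliques, not_not] at hs
      obtain ⟨⟨⟨h1, h2, h3⟩, -⟩, h4⟩ := hs
      refine mem_cliquesIn.2 ⟨fun x hx => mem_filter.2 ⟨?_, ?_⟩, ?_, ?_⟩
      · exact (subset_insert_iff.1 h1) hx
      · exact h3 h4 (mem_of_mem_erase hx) (ne_of_mem_erase hx).symm
      · rw [card_erase_of_mem h4, h2]; rfl
      · exact h3.subset (coe_subset.2 (erase_subset _ _))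
    · obtain ⟨h1, h2, h3⟩ := mem_cliquesIn.1 hs
      have hv : v ∉ s := fun h => hX (nbrsIn_subset X v (h1 h))
      rw [mem_filter, mem_outerCliques, not_not]
      refine ⟨⟨⟨insert_subset_insert _ (h1.trans (nbrsIn_subset X v)), ?_, ?_⟩, ?_⟩,
        mem_insert_self _ _⟩
      · rw [card_insert_of_notMem hv, h2]
      · rw [coe_insert, SimpleGraph.isClique_insert]
        exact ⟨h3, fun x hx _ => (mem_filter.1 (h1 hx)).2⟩
      · exact fun h => hU (h (mem_insert_self _ _))
    · exact insert_erase (not_not.1 (mem_filter.1 hs).2)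
    · exact erase_insert fun h => hX (nbrsIn_subset X v ((mem_cliquesIn.1 hs).1 h))

/-- The bound on outer cliques, by adding the vertices outside `U` one at a time. With `q` the number
of outer `(i + 2)`-cliques, the right side is `kk i q` for `q ≤ N.choose (i + 1)`, and
`N.choose (i + 2) + kk i (q - N.choose (i + 1))` for larger `q`. -/
theorem card_outerCliques_le {U : Finset V} (hU : G.IsClique (U : Set V)) (X : Finset V)
    {i N : ℕ} (hq : #(outerCliques G U (U ∪ X) (i + 2)) < (N + 1).choose (i + 1)) :
    #(outerCliques G U (U ∪ X) (i + 3)) ≤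
      kk i (min #(outerCliques G U (U ∪ X) (i + 2)) (N.choose (i + 1))) +
      kk i (#(outerCliques G U (U ∪ X) (i + 2)) - N.choose (i + 1)) := by
  induction X using Finset.induction_on with
  | empty =>
    have : outerCliques G U (U ∪ ∅) (i + 3) = ∅ := by
      refine eq_empty_of_forall_notMem fun s hs => ?_
      rw [mem_outerCliques, union_empty] at hs
      exact hs.2 hs.1.1
    rw [this, card_empty]
    exact Nat.zero_le _
  | insert v X _ ih =>
    rw [union_insert] at hq ⊢
    by_cases hv : v ∈ U ∪ X
    · rw [insert_eq_of_mem hv] at hq ⊢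
      exact ih hq
    have hvU : v ∉ U := fun h => hv (mem_union_left _ h)
    have e1 := card_outerCliques_insert (G := G) hvU hv (i + 1)
    have e2 := card_outerCliques_insert (G := G) hvU hv (i + 2)
    simp only [add_assoc, Nat.reduceAdd] at e1 e2
    rw [e1] at hq ⊢
    rw [e2]
    have h1 := ih (by omega)
    have h2 := card_cliquesIn_succ_le (G := G) (nbrsIn G (U ∪ X) v) i
    have h3 := card_cliquesIn_eq (X := nbrsIn G (U ∪ X) v) hU (i + 1)
    have h4 := card_cliquesIn_eq (X := nbrsIn G (U ∪ X) v) hU (i + 2)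
    have h5 : #(outerCliques G U (nbrsIn G (U ∪ X) v) (i + 2)) ≤
        #(outerCliques G U (U ∪ X) (i + 2)) := card_le_card fun s hs => by
      rw [mem_outerCliques] at hs ⊢
      exact ⟨⟨hs.1.1.trans (nbrsIn_subset _ _), hs.1.2⟩, hs.2⟩
    have ht : #(nbrsIn G (U ∪ X) v ∩ U) ≤ N := by
      by_contra! h
      have := Nat.choose_le_choose (i + 1) (show N + 1 ≤ _ from h)
      omega
    have h6 := Nat.choose_le_choose (i + 2) ht
    set b := #(cliquesIn G (nbrsIn G (U ∪ X) v) (i + 1))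
    set w := #(outerCliques G U (U ∪ X) (i + 2))
    have hsplit : kk i (min w (N.choose (i + 1))) + kk i (w - N.choose (i + 1)) ≤ kk i w := by
      have := kk_superadditive i (min w (N.choose (i + 1))) (w - N.choose (i + 1))
      rwa [show min w (N.choose (i + 1)) + (w - N.choose (i + 1)) = w by omega] at this
    rcases le_or_gt b (N.choose (i + 1)) with hb | hb
    · rcases le_total w (N.choose (i + 1)) with hw | hw
      · have := kk_add_le hw hb
        omega
      · have := kk_superadditive i (w - N.choose (i + 1)) b
        rw [min_eq_right hw] at h1
        rw [min_eq_right (by omega), Nat.sub_add_comm hw]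
        omega
    · -- The `(i + 2)`-cliques of the neighbourhood of `v` that leave `U` are among the `w` outer
      -- cliques avoiding `v`, so `v` adds at most `N.choose (i + 2) + min w (kk i _)` cliques.
      rw [min_eq_right (by omega), kk_choose]
      rw [Nat.choose_succ_succ'] at hq
      rcases i with _ | i
      · simp only [zero_add, Nat.choose_zero_right] at *
        omega
      obtain ⟨z, hz⟩ : ∃ z, b = N.choose (i + 2) + z := ⟨_, (Nat.add_sub_cancel' hb.le).symm⟩
      have h7 := kk_add_min_le i w z
      simp only [add_assoc, Nat.reduceAdd] at *
      have h8 : kk (i + 1) b = N.choose (i + 3) + kk i z := by rw [hz, kk_succ (by omega)]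
      rw [show w + b - N.choose (i + 2) = w + z by omega]
      omega

end Graph

/-! ### Evaluation on the cascade representation -/

/-- On a cascade, `kk` raises every lower index by one. -/
theorem kk_r {i : ℕ} {a : List ℤ} (ha : IsCascade ((i : ℤ) + 1) a) :
    kk i (r ((i : ℤ) + 1) a) = r ((i : ℤ) + 2) a := by
  induction a generalizing i with
  | nil => simp [r]
  | cons x xs ih =>
    obtain ⟨-, h1, h2, h3⟩ := isCascade_cons.1 ha
    obtain ⟨x, rfl⟩ := Int.eq_ofNat_of_zero_le (show 0 ≤ x by omega)
    have e1 := binom_nat x (i + 1)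
    have e2 := binom_nat x (i + 2)
    have e3 := binom_nat x i
    push_cast at e1 e2 e3
    rw [add_sub_cancel_right] at h3
    have h4 := r_lt_binom h3 (by omega) (by omega) h2
    have e4 : (i : ℤ) + 2 - 1 = i + 1 := by ring
    simp only [r, add_sub_cancel_right, e1, e2, e4]
    rcases i with _ | i
    · have : xs = [] := by
        rcases xs with _ | ⟨y, ys⟩
        · rfl
        · have := (isCascade_cons.1 h3).1
          simp at this
      subst this
      simp [r, kk]
    · push_cast at h3 h4 e3 ⊢
      rw [e3] at h4
      rw [kk_succ h4.le, ih h3]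
      ring_nf

/-- The bound for clique sizes `k = i + 2`. -/
theorem cliqueCount_le_of_isLgbdRep {V : Type*} [Fintype V] (G : SimpleGraph V) (i m : ℕ)
    (hm : cliqueCount G (i + 2) = m) (n n' : ℤ) (a : List ℤ) (hrep : IsLgbdRep (i + 2) m n n' a)
    (hclique : ∃ U : Finset V, G.IsClique (U : Set V) ∧ (#U : ℤ) = n) :
    cliqueCount G (i + 3) ≤ r ((i : ℤ) + 3) [n, n'] + r ((i : ℤ) + 2) a := by
  classical
  obtain ⟨U, hU, rfl⟩ := hclique
  obtain ⟨-, h2, h3, h4, h5⟩ := hrep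
  push_cast at h2 h3 h4 h5
  rw [show (i : ℤ) + 2 - 1 = i + 1 by ring] at h3 h4 h5
  rw [show (i : ℤ) + 2 - 2 = i by ring] at h4
  obtain ⟨N, rfl⟩ := Int.eq_ofNat_of_zero_le (show 0 ≤ n' by omega)
  have e1 := binom_nat #U (i + 2)
  have e2 := binom_nat #U (i + 3)
  have e3 := binom_nat N i
  have e4 := binom_nat N (i + 1)
  have e5 := binom_nat N (i + 2)
  push_cast at e1 e2 e3 e4 e5
  have e6 : (i : ℤ) + 2 - 1 = i + 1 := by ring
  have e7 : (i : ℤ) + 3 - 1 = i + 2 := by ring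
  simp only [r, e1, e2, e3, e4, e5, e6, e7, add_zero] at h4 h5 ⊢
  have c1 := card_cliquesIn_eq (X := univ) hU (i + 2)
  have c2 := card_cliquesIn_eq (X := univ) hU (i + 3)
  rw [← cliqueCount_eq, univ_inter] at c1 c2
  have hle := card_outerCliques_le hU univ (i := i) (N := N)
  rw [show U ∪ univ = univ from (subset_univ _).antisymm subset_union_right] at hle
  have hq : #(outerCliques G U univ (i + 2)) = N.choose (i + 1) + r ((i : ℤ) + 1) a := by
    omega
  rw [hq, Nat.choose_succ_succ', min_eq_right (by omega), Nat.add_sub_cancel_left, kk_choose,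
    kk_r h3] at hle
  have := hle (by omega)
  omega

/-- For `k = 1` the clique on `n` vertices is the whole graph. -/
theorem cliqueCount_two_le {V : Type*} [Fintype V] (G : SimpleGraph V) (m : ℕ)
    (hm : cliqueCount G 1 = m) (n n' : ℤ) (a : List ℤ) (hrep : IsLgbdRep 1 m n n' a)
    (hclique : ∃ U : Finset V, G.IsClique (U : Set V) ∧ (#U : ℤ) = n) :
    cliqueCount G 2 ≤ r 2 [n, n'] + r 1 a := by
  classical
  obtain ⟨U, hU, rfl⟩ := hclique
  have e1 := binom_nat #U 1
  have e2 := binom_nat #U 2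
  push_cast at e1 e2
  -- `C(n', -1) > 0` forces `n' = -1`.
  have hn' : n' = -1 := by
    by_contra hne
    have h4 := hrep.small
    simp only [r, binom] at h4
    rw [if_neg (by simpa using hne)] at h4
    simp at h4
  have ha : a = [] := by
    rcases a with _ | ⟨y, ys⟩
    · rfl
    · simpa using (isCascade_cons.1 hrep.cascade).1
  have h5 := hrep.eq
  subst hn' ha
  have e3 : binom (-1) 0 = 0 := by simp [binom]
  simp only [r, Nat.cast_one, e1, sub_self, e3, Nat.choose_one_right, add_zero] at h5
  simp only [r, e2]
  have c1 := card_cliquesIn_eq (X := univ) hU 1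
  have c2 := card_cliquesIn_eq (X := univ) hU 2
  rw [← cliqueCount_eq, univ_inter] at c1 c2
  rw [Nat.choose_one_right] at c1
  have h0 : outerCliques G U univ 1 = ∅ := card_eq_zero.1 (by omega)
  have h1 : outerCliques G U univ 2 = ∅ := by
    refine eq_empty_of_forall_notMem fun s hs => ?_
    obtain ⟨x, -, hx⟩ := not_subset.1 (mem_outerCliques.1 hs).2
    refine notMem_empty {x} (h0 ▸ mem_outerCliques.2 ⟨⟨subset_univ _, card_singleton x, ?_⟩, ?_⟩)
    · simp
    · simpa using hx
  rw [h1, card_empty] at c2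
  omega

end CliqueBound

theorem lemma3p6 {V : Type*} [Finite V] (G : SimpleGraph V) (k m : ℕ) (hk : 0 < k)
    (hm : CliqueBound.cliqueCount G k = m)
    (n n' : ℤ) (a : List ℤ) (hrep : CliqueBound.IsLgbdRep k m n n' a)
    (hclique : ∃ U : Finset V, G.IsClique (U : Set V) ∧ (U.card : ℤ) = n) :
    CliqueBound.cliqueCount G (k + 1) ≤ CliqueBound.lgbd k m ∧
      CliqueBound.lgbd k m = CliqueBound.r (k + 1) [n, n'] + CliqueBound.r k a := by
  have := Fintype.ofFinite V
  rw [CliqueBound.lgbd_eq hk hrep]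
  refine ⟨?_, rfl⟩
  obtain rfl | ⟨i, rfl⟩ : k = 1 ∨ ∃ i, k = i + 2 := by
    rcases k with _ | _ | k
    · omega
    · exact .inl rfl
    · exact .inr ⟨k, rfl⟩
  · simpa using CliqueBound.cliqueCount_two_le G m hm n n' a hrep hclique
  · have := CliqueBound.cliqueCount_le_of_isLgbdRep G i m hm n n' a hrep hclique
    push_cast
    rwa [show (i : ℤ) + 2 + 1 = i + 3 by ring]
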